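/- Let $G$ be an $n$-dimensional Lie group ($n\ge 2$) with a bi-invariant Riemannian metric. Let $F\colon M\to G$ be a regular (i.e. smoothly immersed) surface, $M$ a non-empty smooth $2$-manifold, which is a translation surface: around every point of $M$ there are smooth local coordinates $(s,t)$ in which $F$ has the form $f(s,t)=a(s)\cdot b(t)$, where $a$ and $b$ are smooth curves in $G$ and the product is the group multiplication. If the Gaussian curvature of the induced metric on $M$ is a constant $K$, then $K=0$, that is, the surface is flat. -/

import Mathlib

open scoped Manifold ContDiff

noncomputable section

namespace TranslationSurface

/-! ### Gaussian curvature of a metric on a plane coordinate domain -/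

/-- The coordinate vectors `∂₀ = (1, 0)` and `∂₁ = (0, 1)` of the plane. -/
def coordVec : Fin 2 → ℝ × ℝ := ![(1, 0), (0, 1)]

/-- The partial derivative `∂ᵢ h` at `q`. -/
def partialD (i : Fin 2) (h : ℝ × ℝ → ℝ) (q : ℝ × ℝ) : ℝ :=
  fderiv ℝ h q (coordVec i)

/-- The Christoffel symbol
`Γᵏᵢⱼ = ½ ∑ₗ γᵏˡ (∂ᵢ γⱼₗ + ∂ⱼ γᵢₗ - ∂ₗ γᵢⱼ)`
of the Levi-Civita connection of the metric `γ`. -/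
def christoffel (γ : ℝ × ℝ → Matrix (Fin 2) (Fin 2) ℝ) (k i j : Fin 2) (q : ℝ × ℝ) : ℝ :=
  (1 / 2) * ∑ l, (γ q)⁻¹ k l *
    (partialD i (fun x => γ x j l) q + partialD j (fun x => γ x i l) q
      - partialD l (fun x => γ x i j) q)

/-- The components of the curvature tensor, `R(∂ᵢ, ∂ⱼ) ∂ₖ = ∑ₗ (curvatureTensor γ l i j k) ∂ₗ`,
with `R(X, Y) Z = ∇_X ∇_Y Z - ∇_Y ∇_X Z - ∇_[X, Y] Z`. -/
def curvatureTensor (γ : ℝ × ℝ → Matrix (Fin 2) (Fin 2) ℝ) (l i j k : Fin 2) (q : ℝ × ℝ) : ℝ :=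
  partialD i (christoffel γ l j k) q - partialD j (christoffel γ l i k) q
    + ∑ m, (christoffel γ l i m q * christoffel γ m j k q
      - christoffel γ l j m q * christoffel γ m i k q)

/-- The Gaussian curvature `⟨R(∂₀, ∂₁) ∂₁, ∂₀⟩ / det γ` of the metric `γ`. -/
def coordGaussCurvature (γ : ℝ × ℝ → Matrix (Fin 2) (Fin 2) ℝ) (q : ℝ × ℝ) : ℝ :=
  (∑ l, γ q 0 l * curvatureTensor γ l 0 1 1 q) / (γ q).det

/-! ### Bi-invariant metrics, and surfaces in a Riemannian Lie group -/

variable {n : ℕ} {G : Type*} [TopologicalSpace G] [ChartedSpace (EuclideanSpace ℝ (Fin n)) G]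
  [IsManifold (𝓡 n) ∞ G]

/-- The metric is bi-invariant: all left translations and all right translations are isometries. -/
def IsBiInvariant [Group G]
    (g : Bundle.ContMDiffRiemannianMetric (𝓡 n) ∞ (EuclideanSpace ℝ (Fin n))
      (fun x : G => TangentSpace (𝓡 n) x)) : Prop :=
  (∀ (h x : G) (v w : TangentSpace (𝓡 n) x),
    g.inner (h * x) (mfderiv (𝓡 n) (𝓡 n) (fun y : G => h * y) x v)
      (mfderiv (𝓡 n) (𝓡 n) (fun y : G => h * y) x w) = g.inner x v w) ∧
  (∀ (h x : G) (v w : TangentSpace (𝓡 n) x),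
    g.inner (x * h) (mfderiv (𝓡 n) (𝓡 n) (fun y : G => y * h) x v)
      (mfderiv (𝓡 n) (𝓡 n) (fun y : G => y * h) x w) = g.inner x v w)

/-- The matrix (first fundamental form) `⟨∂ᵢ x, ∂ⱼ x⟩` of the metric induced by a parametrization
`x` of a surface piece. -/
def firstFundamentalForm
    (g : Bundle.ContMDiffRiemannianMetric (𝓡 n) ∞ (EuclideanSpace ℝ (Fin n))
      (fun x : G => TangentSpace (𝓡 n) x))
    (x : ℝ × ℝ → G) (q : ℝ × ℝ) : Matrix (Fin 2) (Fin 2) ℝ :=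
  Matrix.of fun i j => g.inner (x q)
    (mfderiv 𝓘(ℝ, ℝ × ℝ) (𝓡 n) x q (coordVec i : ℝ × ℝ))
    (mfderiv 𝓘(ℝ, ℝ × ℝ) (𝓡 n) x q (coordVec j : ℝ × ℝ))

variable {M : Type*} [TopologicalSpace M] [ChartedSpace (ℝ × ℝ) M]

/-- The smooth map `F : M → G` is a regular (that is, immersed) surface in `G`. -/
def IsRegularSurface (F : M → G) : Prop :=
  ContMDiff 𝓘(ℝ, ℝ × ℝ) (𝓡 n) ∞ F ∧
    ∀ p : M, Function.Injective (mfderiv 𝓘(ℝ, ℝ × ℝ) (𝓡 n) F p)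

/-- At the point `p` the surface `F : M → G` has Gaussian curvature `K`: this is the curvature at
`p` of the metric induced from `g`, computed in smooth local coordinates of `M` around `p` (the
value does not depend on the coordinates). -/
def HasGaussCurvatureAt
    (g : Bundle.ContMDiffRiemannianMetric (𝓡 n) ∞ (EuclideanSpace ℝ (Fin n))
      (fun x : G => TangentSpace (𝓡 n) x))
    (F : M → G) (p : M) (K : ℝ) : Prop :=
  ∀ φ ∈ IsManifold.maximalAtlas 𝓘(ℝ, ℝ × ℝ) ∞ M, p ∈ φ.source →
    coordGaussCurvature (firstFundamentalForm g (F ∘ φ.symm)) (φ p) = K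

/-- The surface `F : M → G` is a translation surface: around each point of `M` there are smooth
local coordinates `(s, t)`, ranging over a product of two open intervals, and two smooth curves `a`,
`b` in `G`, such that the surface is `(s, t) ↦ a s * b t` in these coordinates. -/
def IsTranslationSurface [Group G] (F : M → G) : Prop :=
  ∀ p : M, ∃ φ ∈ IsManifold.maximalAtlas 𝓘(ℝ, ℝ × ℝ) ∞ M, p ∈ φ.source ∧
    ∃ (I J : Set ℝ) (a b : ℝ → G), IsOpen I ∧ I.OrdConnected ∧ IsOpen J ∧ J.OrdConnected ∧
      φ.target = I ×ˢ J ∧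
      ContMDiffOn 𝓘(ℝ, ℝ) (𝓡 n) ∞ a I ∧ ContMDiffOn 𝓘(ℝ, ℝ) (𝓡 n) ∞ b J ∧
      ∀ s ∈ I, ∀ t ∈ J, F (φ.symm (s, t)) = a s * b t

end TranslationSurface

end

/-!
Translating by `a(s)⁻¹` on the left and `b(t)⁻¹` on the right, which are isometries, shows that the
metric induced by `(s, t) ↦ a(s) b(t)` is `|α|² ds² + 2⟨α, β⟩ ds dt + |β|² dt²`, where `α(s)` and
`β(t)` are the left and right logarithmic derivatives of `a` and `b`: two curves in the Euclidean
space `T₁G` (`firstFundamentalForm_mul`). From here on the group plays no role.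

Let `f(s, t)` be the cosine of the angle between `α(s)` and `β(t)`. For arc length parameters the
Gauss equation is `(1 - f²) fₛₜ + f fₛ fₜ = K (1 - f²)²` (`coordGaussCurvature_mul_det_sq`); in terms
of the angle it is the sine-Gordon equation. It says that `g := fₜ² / (1 - f²)`, the squared
`t`-derivative of the angle, satisfies `gₛ = 2 K fₜ`. Since `f` is a finite sum of products
`aᵢ(s) bᵢ(t)`, integration in `s` shows that `g` is such a sum as well.

So `f` and `g` are of finite rank, and `g (1 - f)(1 + f) = fₜ²`. This alone forces `g(·, t)` to be
constant for some `t` (`exists_constant_slice`). In algebraic terms, on the variety on which the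
functions `aᵢ` live, `g(·, t)` has no poles for general `t`, neither where `f = ±1` nor at infinity,
so it is constant. The proof is an elementary version of this: for many points `t_j` in general
position put `x_j = 1 - f(·, t_j)` and `y_j = 1 + f(·, t_j)`; the span of the products
`∏_{S} x_j ∏_{T} y_j`, with `S` and `T` running over the large index sets of a fixed size, is
finite-dimensional and stable under multiplication by each `g(·, t_k)`
(`finite_range_of_general_position`). Hence the values of `g(·, t_k)` are eigenvalues of one fixed
matrix, they are finitely many, and by continuity `g(·, t_k)` is constant.

If `K ≠ 0`, then `gₛ = 2 K fₜ` gives `fₜ = 0` along such a line `t = t_k`, so `fₛₜ = 0` there too,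
and the Gauss equation becomes `K (1 - f²)² = 0`, which is impossible because `|f| < 1`.
-/

noncomputable section

namespace TranslationSurface

open scoped Pointwise

/-! ### Functions that stabilize a finite-dimensional function space -/

/-- Multiplication by `g` is an endomorphism of `M`, and every value of `g` is a root of its
characteristic polynomial. -/
theorem finite_range_of_mul_mem {σ : Type*} (M : Submodule ℝ (σ → ℝ)) [FiniteDimensional ℝ M]
    (g : σ → ℝ) (hg : ∀ m ∈ M, g * m ∈ M) (hM : ∀ s, ∃ m ∈ M, m s ≠ 0) :
    (Set.range g).Finite := by
  let φ : Module.End ℝ M := (LinearMap.mulLeft ℝ g).restrict hg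
  have hφ : ∀ m : M, ((φ m : M) : σ → ℝ) = g * m := fun m => rfl
  have key : ∀ (P : Polynomial ℝ) (m : M) (s : σ),
      ((Polynomial.aeval φ P m : M) : σ → ℝ) s = P.eval (g s) * (m : σ → ℝ) s := by
    intro P
    induction P using Polynomial.induction_on' with
    | add p q hp hq =>
      intro m s
      simp [hp, hq, add_mul]
    | monomial k a =>
      intro m s
      have hpow : ∀ k : ℕ, (((φ ^ k) m : M) : σ → ℝ) s = g s ^ k * (m : σ → ℝ) s := by
        intro k
        induction k with
        | zero => simp
        | succ k ih => rw [pow_succ', Module.End.mul_apply, hφ, Pi.mul_apply, ih]; ring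
      simp [Polynomial.aeval_monomial, hpow, mul_assoc]
  refine (φ.charpoly.rootSet_finite ℝ).subset ?_
  rintro _ ⟨s, rfl⟩
  obtain ⟨m, hm, hms⟩ := hM s
  rw [Polynomial.mem_rootSet]
  refine ⟨φ.charpoly_monic.ne_zero, ?_⟩
  have h := key φ.charpoly ⟨m, hm⟩ s
  rw [LinearMap.aeval_self_charpoly] at h
  simpa [hms, Polynomial.aeval_def, Polynomial.eval₂_eq_eval_map] using h.symm

/-- Exchange: a product over `S` with the factor at `j` replaced by a linear combination `z` is a
combination of products over sets of the same size. -/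
theorem mul_prod_erase_mem_span {σ ι : Type*} [Fintype ι] [DecidableEq ι] (r : ℕ)
    (x : ι → σ → ℝ) (z : σ → ℝ)
    (hx : ∀ S : Finset ι, r ≤ S.card → z ∈ Submodule.span ℝ (x '' (S : Set ι)))
    (S : Finset ι) (hS : S.card + r ≤ Fintype.card ι + 1) {j : ι} (hj : j ∈ S) :
    z * ∏ i ∈ S.erase j, x i ∈ Submodule.span ℝ
      ((fun S' : Finset ι => ∏ i ∈ S', x i) '' {S' | S'.card = S.card}) := by
  have hc : r ≤ (S.erase j)ᶜ.card := by
    rw [Finset.card_compl, Finset.card_erase_of_mem hj]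
    have := Finset.card_pos.mpr ⟨j, hj⟩
    omega
  have := Submodule.mem_map_of_mem (f := LinearMap.mulRight ℝ (∏ i ∈ S.erase j, x i)) (hx _ hc)
  rw [Submodule.map_span] at this
  refine Submodule.span_mono ?_ this
  rintro _ ⟨_, ⟨k, hk, rfl⟩, rfl⟩
  have hk' : k ∉ S.erase j := Finset.mem_compl.mp hk
  refine ⟨insert k (S.erase j), ?_, ?_⟩
  · have := Finset.card_pos.mpr ⟨j, hj⟩
    simp only [Set.mem_ofPred_eq, Finset.card_insert_of_notMem hk', Finset.card_erase_of_mem hj]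
    omega
  · simp [Finset.prod_insert hk']

/-- If every `z k` is a combination of any `r` of the `x j` and of any `r` of the `y j`, every `g k`
is a combination of any `r` of the `g j`, and `g j * x j * y j = z j ^ 2`, then each `g k` takes
finitely many values: it stabilizes the span of the products `(∏ i ∈ S, x i) * ∏ i ∈ T, y i` with `#S = #T = 2 * r + 1`. -/
theorem finite_range_of_general_position {σ ι : Type*} [Fintype ι] [DecidableEq ι] (r : ℕ)
    (hcard : Fintype.card ι = 3 * r) (x y z g : ι → σ → ℝ)
    (hx : ∀ S : Finset ι, r ≤ S.card → ∀ j, z j ∈ Submodule.span ℝ (x '' (S : Set ι)))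
    (hy : ∀ S : Finset ι, r ≤ S.card → ∀ j, z j ∈ Submodule.span ℝ (y '' (S : Set ι)))
    (hg : ∀ S : Finset ι, r ≤ S.card → ∀ j, g j ∈ Submodule.span ℝ (g '' (S : Set ι)))
    (hrel : ∀ j, g j * (x j * y j) = z j * z j)
    (hx0 : ∀ j s, x j s ≠ 0) (hy0 : ∀ j s, y j s ≠ 0) (k : ι) :
    (Set.range (g k)).Finite := by
  have hr : 0 < r := by
    have := Fintype.card_pos_iff.mpr ⟨k⟩
    omega
  let A : Set (σ → ℝ) := (fun S : Finset ι => ∏ i ∈ S, x i) '' {S | S.card = 2 * r + 1}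
  let A' : Set (σ → ℝ) := (fun S : Finset ι => ∏ i ∈ S, y i) '' {S | S.card = 2 * r + 1}
  let M : Submodule ℝ (σ → ℝ) := Submodule.span ℝ A * Submodule.span ℝ A'
  have hA : A.Finite := (Set.toFinite _).image _
  have hA' : A'.Finite := (Set.toFinite _).image _
  have hMs : M = Submodule.span ℝ (A * A') := Submodule.span_mul_span ℝ A A'
  have : FiniteDimensional ℝ M := by
    rw [hMs]
    exact FiniteDimensional.span_of_finite ℝ (hA.mul hA')
  obtain ⟨S₀, -, hS₀⟩ := Finset.exists_subset_card_eq
    (s := (Finset.univ : Finset ι)) (n := 2 * r + 1) (by rw [Finset.card_univ]; omega)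
  refine finite_range_of_mul_mem M (g k) ?_ ?_
  · suffices h : M ≤ M.comap (LinearMap.mulLeft ℝ (g k)) from fun m hm => h hm
    conv_lhs => rw [hMs]
    rw [Submodule.span_le]
    rintro _ ⟨_, ⟨S, hS, rfl⟩, _, ⟨T, hT, rfl⟩, rfl⟩
    simp only [Set.mem_ofPred_eq] at hS hT
    -- `S` and `T` are so large that `r` indices are common to them.
    have hST : r ≤ (S ∩ T).card := by
      have h1 := Finset.card_union_add_card_inter S T
      have h2 := Finset.card_le_univ (S ∪ T)
      omega
    have := Submodule.mem_map_of_mem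
      (f := LinearMap.mulRight ℝ ((∏ i ∈ S, x i) * ∏ i ∈ T, y i)) (hg _ hST k)
    rw [Submodule.map_span] at this
    change g k * ((∏ i ∈ S, x i) * ∏ i ∈ T, y i) ∈ M
    have hle : Submodule.span ℝ (LinearMap.mulRight ℝ ((∏ i ∈ S, x i) * ∏ i ∈ T, y i) ''
        (g '' ((S ∩ T : Finset ι) : Set ι))) ≤ M := by
      rw [Submodule.span_le]
      rintro _ ⟨_, ⟨j, hj, rfl⟩, rfl⟩
      have hjS : j ∈ S := (Finset.mem_inter.mp hj).1
      have hjT : j ∈ T := (Finset.mem_inter.mp hj).2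
      have e : g j * ((∏ i ∈ S, x i) * ∏ i ∈ T, y i)
          = (z j * ∏ i ∈ S.erase j, x i) * (z j * ∏ i ∈ T.erase j, y i) := by
        rw [← Finset.mul_prod_erase S x hjS, ← Finset.mul_prod_erase T y hjT]
        linear_combination ((∏ i ∈ S.erase j, x i) * ∏ i ∈ T.erase j, y i) * hrel j
      change g j * ((∏ i ∈ S, x i) * ∏ i ∈ T, y i) ∈ M
      rw [e]
      refine Submodule.mul_mem_mul ?_ ?_
      · have := mul_prod_erase_mem_span r x (z j) (fun S hS => hx S hS j) S (by omega) hjS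
        rwa [hS] at this
      · have := mul_prod_erase_mem_span r y (z j) (fun S hS => hy S hS j) T (by omega) hjT
        rwa [hT] at this
    exact hle this
  · intro s
    refine ⟨(∏ i ∈ S₀, x i) * ∏ i ∈ S₀, y i,
      Submodule.mul_mem_mul (Submodule.subset_span ⟨S₀, hS₀, rfl⟩)
        (Submodule.subset_span ⟨S₀, hS₀, rfl⟩), ?_⟩
    simp only [Pi.mul_apply, Finset.prod_apply]
    exact mul_ne_zero (Finset.prod_ne_zero_iff.mpr fun i _ => hx0 i s)
      (Finset.prod_ne_zero_iff.mpr fun i _ => hy0 i s)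

/-! ### Points in general position on a curve -/

/-- A continuous curve, restricted to a suitable open set `O`, is not contained in any proper
subspace of its span, even after shrinking `O`. -/
theorem exists_open_span_stable {Z : Type*} [NormedAddCommGroup Z] [NormedSpace ℝ Z]
    [FiniteDimensional ℝ Z] (Γ : ℝ → Z) {J : Set ℝ} (hJ : IsOpen J) (hJne : J.Nonempty) :
    ∃ O ⊆ J, IsOpen O ∧ O.Nonempty ∧ ∀ O' ⊆ O, IsOpen O' → O'.Nonempty →
      Submodule.span ℝ (Γ '' O') = Submodule.span ℝ (Γ '' O) := by
  -- Take `O` with a span of the least possible dimension.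
  let P : ℕ → Prop := fun d => ∃ O ⊆ J, IsOpen O ∧ O.Nonempty ∧
    Module.finrank ℝ (Submodule.span ℝ (Γ '' O)) = d
  have hP : ∃ d, P d := ⟨_, J, subset_rfl, hJ, hJne, rfl⟩
  classical
  obtain ⟨O, hOJ, hO, hOne, hd⟩ := Nat.find_spec hP
  refine ⟨O, hOJ, hO, hOne, fun O' hO'O hO' hO'ne => ?_⟩
  refine Submodule.eq_of_le_of_finrank_le (Submodule.span_mono (Set.image_mono hO'O)) ?_
  rw [hd]
  exact Nat.find_min' hP ⟨O', hO'O.trans hOJ, hO', hO'ne, rfl⟩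

/-- Finitely many subspaces that do not contain the whole curve are avoided on a smaller open set. -/
theorem exists_notMem_subspaces {Z : Type*} [NormedAddCommGroup Z] [NormedSpace ℝ Z]
    [FiniteDimensional ℝ Z] {Γ : ℝ → Z} {O : Set ℝ} (hO : IsOpen O) (hOne : O.Nonempty)
    (hΓ : ContinuousOn Γ O)
    (hst : ∀ O' ⊆ O, IsOpen O' → O'.Nonempty →
      Submodule.span ℝ (Γ '' O') = Submodule.span ℝ (Γ '' O))
    (H : Finset (Submodule ℝ Z)) :
    ∃ O' ⊆ O, IsOpen O' ∧ O'.Nonempty ∧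
      ∀ U ∈ H, ¬ Submodule.span ℝ (Γ '' O) ≤ U → ∀ t ∈ O', Γ t ∉ U := by
  classical
  induction H using Finset.induction_on with
  | empty => exact ⟨O, subset_rfl, hO, hOne, by simp⟩
  | insert U H hU ih =>
    obtain ⟨O', hO'O, hO', hO'ne, h⟩ := ih
    by_cases hle : Submodule.span ℝ (Γ '' O) ≤ U
    · refine ⟨O', hO'O, hO', hO'ne, fun W hW hWle t ht => ?_⟩
      rcases Finset.mem_insert.mp hW with rfl | hW
      · exact absurd hle hWle
      · exact h W hW hWle t ht
    · refine ⟨O' ∩ Γ ⁻¹' (U : Set Z)ᶜ, Set.inter_subset_left.trans hO'O,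
        (hΓ.mono hO'O).isOpen_inter_preimage hO' U.closed_of_finiteDimensional.isOpen_compl,
        ?_, fun W hW hWle t ht => ?_⟩
      · by_contra hne
        rw [Set.not_nonempty_iff_eq_empty] at hne
        apply hle
        rw [← hst O' hO'O hO' hO'ne, Submodule.span_le]
        rintro _ ⟨t, ht, rfl⟩
        by_contra hn
        exact (hne ▸ (⟨ht, hn⟩ : t ∈ O' ∩ Γ ⁻¹' (U : Set Z)ᶜ) : t ∈ (∅ : Set ℝ))
      · rcases Finset.mem_insert.mp hW with rfl | hW
        · exact ht.2
        · exact h W hW hWle t ht.1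

/-- There are arbitrarily large finite sets of parameters in general position: any `dim Z` of the
corresponding points span the same subspace as the whole curve. -/
theorem exists_general_position {Z : Type*} [NormedAddCommGroup Z] [NormedSpace ℝ Z]
    [FiniteDimensional ℝ Z] {Γ : ℝ → Z} {O : Set ℝ} (hO : IsOpen O) (hOne : O.Nonempty)
    (hΓ : ContinuousOn Γ O)
    (hst : ∀ O' ⊆ O, IsOpen O' → O'.Nonempty →
      Submodule.span ℝ (Γ '' O') = Submodule.span ℝ (Γ '' O)) (N : ℕ) :
    ∃ T : Finset ℝ, (T : Set ℝ) ⊆ O ∧ T.card = N ∧ ∀ S ⊆ T, Module.finrank ℝ Z ≤ S.card →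
      Submodule.span ℝ (Γ '' O) ≤ Submodule.span ℝ (Γ '' (S : Set ℝ)) := by
  classical
  suffices h : ∃ T : Finset ℝ, (T : Set ℝ) ⊆ O ∧ T.card = N ∧ ∀ S ⊆ T,
      Submodule.span ℝ (Γ '' O) ≤ Submodule.span ℝ (Γ '' (S : Set ℝ)) ∨
        S.card ≤ Module.finrank ℝ (Submodule.span ℝ (Γ '' (S : Set ℝ))) by
    obtain ⟨T, hTO, hT, h⟩ := h
    refine ⟨T, hTO, hT, fun S hS hc => (h S hS).elim id fun h' => ?_⟩
    rw [Submodule.eq_top_of_finrank_eq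
      (le_antisymm (Submodule.finrank_le _) (hc.trans h'))]
    exact le_top
  induction N with
  | zero => exact ⟨∅, by simp, by simp, fun S hS => Or.inr (by simp [Finset.subset_empty.mp hS])⟩
  | succ N ih =>
    obtain ⟨T, hTO, hT, h⟩ := ih
    obtain ⟨O', hO'O, hO', hO'ne, hav⟩ := exists_notMem_subspaces hO hOne hΓ hst
      (T.powerset.image fun S : Finset ℝ => Submodule.span ℝ (Γ '' (S : Set ℝ)))
    obtain ⟨t, ht, htT⟩ : ∃ t ∈ O', t ∉ T := by
      have hinf : O'.Infinite := by
        obtain ⟨t, ht⟩ := hO'ne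
        exact infinite_of_mem_nhds t (hO'.mem_nhds ht)
      exact hinf.exists_notMem_finset T
    refine ⟨insert t T, ?_, by rw [Finset.card_insert_of_notMem htT, hT], fun S hS => ?_⟩
    · rw [Finset.coe_insert]
      exact Set.insert_subset (hO'O ht) hTO
    by_cases htS : t ∈ S
    · have hS' : S.erase t ⊆ T := Finset.subset_insert_iff.mp hS
      have hcov : (S : Set ℝ) = insert t ((S.erase t : Finset ℝ) : Set ℝ) := by
        rw [← Finset.coe_insert, Finset.insert_erase htS]
      by_cases hle : Submodule.span ℝ (Γ '' O) ≤
          Submodule.span ℝ (Γ '' ((S.erase t : Finset ℝ) : Set ℝ))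
      · left
        refine hle.trans (Submodule.span_mono (Set.image_mono ?_))
        exact_mod_cast Finset.erase_subset t S
      · right
        have hnot : Γ t ∉ Submodule.span ℝ (Γ '' ((S.erase t : Finset ℝ) : Set ℝ)) :=
          hav _ (Finset.mem_image_of_mem _ (Finset.mem_powerset.mpr hS')) hle t ht
        have hlt : Submodule.span ℝ (Γ '' ((S.erase t : Finset ℝ) : Set ℝ)) <
            Submodule.span ℝ (Γ '' (S : Set ℝ)) := by
          refine lt_of_le_of_ne (Submodule.span_mono (Set.image_mono ?_)) fun he => hnot ?_
          · exact_mod_cast Finset.erase_subset t S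
          · rw [he]
            exact Submodule.subset_span ⟨t, htS, rfl⟩
        have h1 := Submodule.finrank_lt_finrank_of_lt hlt
        have h2 := (h _ hS').resolve_left hle
        have h3 := Finset.card_erase_add_one htS
        omega
    · exact h S ((Finset.subset_insert_iff_of_notMem htS).mp hS)

/-- The derivative of a curve lies in the span of the curve. -/
theorem hasDerivAt_mem_span {Z : Type*} [NormedAddCommGroup Z] [NormedSpace ℝ Z]
    [FiniteDimensional ℝ Z] {γ : ℝ → Z} {γ' : Z} {O : Set ℝ} (hO : IsOpen O) {t : ℝ} (ht : t ∈ O)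
    (h : HasDerivAt γ γ' t) : γ' ∈ Submodule.span ℝ (γ '' O) := by
  have hcl := (Submodule.span ℝ (γ '' O)).closed_of_finiteDimensional
  refine hcl.mem_of_tendsto (hasDerivAt_iff_tendsto_slope.mp h) ?_
  filter_upwards [nhdsWithin_le_nhds (hO.mem_nhds ht)] with t' ht'
  rw [slope_def_module]
  exact Submodule.smul_mem _ _ (Submodule.sub_mem _ (Submodule.subset_span ⟨t', ht', rfl⟩)
    (Submodule.subset_span ⟨t, ht, rfl⟩))

/-- Let `f(s, t) = Λ s (b t)` and `g(s, t) = Θ s (c t)` be functions of finite rank with `f² < 1` and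
`g (1 - f²) = fₜ²`. Then `g(·, t)` is constant for some `t`. -/
theorem exists_constant_slice {V W : Type*} [NormedAddCommGroup V] [NormedSpace ℝ V]
    [FiniteDimensional ℝ V] [NormedAddCommGroup W] [NormedSpace ℝ W] [FiniteDimensional ℝ W]
    {I J : Set ℝ} (hI : IsPreconnected I) (hJ : IsOpen J) (hJne : J.Nonempty)
    (Λ : ℝ → V →ₗ[ℝ] ℝ) (b b' : ℝ → V) (hb : ∀ t ∈ J, HasDerivAt b (b' t) t)
    (Θ : ℝ → W →ₗ[ℝ] ℝ) (c : ℝ → W) (hc : ContinuousOn c J)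
    (hcont : ∀ t ∈ J, ContinuousOn (fun s => Θ s (c t)) I)
    (hlt : ∀ s ∈ I, ∀ t ∈ J, (Λ s (b t)) ^ 2 < 1)
    (hrel : ∀ s ∈ I, ∀ t ∈ J, Θ s (c t) * (1 - (Λ s (b t)) ^ 2) = (Λ s (b' t)) ^ 2) :
    ∃ t ∈ J, ∀ s ∈ I, ∀ s' ∈ I, Θ s (c t) = Θ s' (c t) := by
  classical
  -- `1 - f` and `1 + f` are linear functions of `γ = (1, b)`; general position is needed for `γ` and
  -- for `c`, so it is arranged for the joint curve `Γ`.
  let γ : ℝ → ℝ × V := fun t => (1, b t)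
  let Γ : ℝ → (ℝ × V) × W := fun t => (γ t, c t)
  have hbc : ContinuousOn b J := fun t ht => (hb t ht).continuousAt.continuousWithinAt
  have hΓ : ContinuousOn Γ J := (continuousOn_const.prodMk hbc).prodMk hc
  obtain ⟨O, hOJ, hO, hOne, hst⟩ := exists_open_span_stable Γ hJ hJne
  set r := Module.finrank ℝ ((ℝ × V) × W) with hr
  have hrpos : 0 < r := by
    rw [hr, Module.finrank_prod, Module.finrank_prod, Module.finrank_self]; omega
  obtain ⟨T, hTO, hT, hgp⟩ := exists_general_position hO hOne (hΓ.mono hOJ) hst (3 * r)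
  obtain ⟨t₀, ht₀⟩ : T.Nonempty := Finset.card_pos.mp (by omega)
  refine ⟨t₀, hOJ (hTO ht₀), ?_⟩
  -- Any linear image of the joint curve inherits the general position property.
  have himg : ∀ {X : Type _} [AddCommGroup X] [Module ℝ X] (L : (ℝ × V) × W →ₗ[ℝ] X)
      (S : Finset T), r ≤ S.card →
      (Submodule.span ℝ (Γ '' O)).map L ≤ Submodule.span ℝ ((fun t : T => L (Γ t)) '' S) := by
    intro X _ _ L S hS
    have h1 := hgp (S.map (Function.Embedding.subtype _))
      (by intro t ht; obtain ⟨u, -, rfl⟩ := Finset.mem_map.mp ht; exact u.2)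
      (by rwa [Finset.card_map])
    refine (Submodule.map_mono h1).trans ?_
    rw [Submodule.map_span]
    refine Submodule.span_mono ?_
    rintro _ ⟨_, ⟨t, ht, rfl⟩, rfl⟩
    obtain ⟨u, hu, rfl⟩ := Finset.mem_map.mp ht
    exact ⟨u, hu, rfl⟩
  let ξ : (ℝ × V) × W →ₗ[ℝ] (I → ℝ) := LinearMap.pi fun s =>
    (LinearMap.coprod LinearMap.id (-(Λ s))) ∘ₗ LinearMap.fst ℝ (ℝ × V) W
  let η : (ℝ × V) × W →ₗ[ℝ] (I → ℝ) := LinearMap.pi fun s =>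
    (LinearMap.coprod LinearMap.id (Λ s)) ∘ₗ LinearMap.fst ℝ (ℝ × V) W
  let θ : (ℝ × V) × W →ₗ[ℝ] (I → ℝ) := LinearMap.pi fun s =>
    (Θ s) ∘ₗ LinearMap.snd ℝ (ℝ × V) W
  have hγ' : ∀ t ∈ O, (0, b' t) ∈ (Submodule.span ℝ (Γ '' O)).map (LinearMap.fst ℝ (ℝ × V) W) := by
    intro t ht
    have : HasDerivAt γ (0, b' t) t := (hasDerivAt_const t (1 : ℝ)).prodMk (hb t (hOJ ht))
    have := hasDerivAt_mem_span hO ht this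
    rw [Submodule.map_span, Set.image_image]
    exact this
  have hfin := finite_range_of_general_position (σ := I) (ι := T) r
    (by rw [Fintype.card_coe, hT])
    (fun t s => 1 - Λ s (b t)) (fun t s => 1 + Λ s (b t)) (fun t s => Λ s (b' t))
    (fun t s => Θ s (c t)) ?_ ?_ ?_ ?_ ?_ ?_ ⟨t₀, ht₀⟩
  · have hconn : IsPreconnected ((fun s => Θ s (c t₀)) '' I) :=
      hI.image _ (hcont t₀ (hOJ (hTO ht₀)))
    have hfin' : ((fun s => Θ s (c t₀)) '' I).Finite := by
      refine hfin.subset ?_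
      rintro _ ⟨s, hs, rfl⟩
      exact ⟨⟨s, hs⟩, rfl⟩
    have hsub := hfin'.countable.isTotallyDisconnected _ subset_rfl hconn
    exact fun s hs s' hs' => hsub ⟨s, hs, rfl⟩ ⟨s', hs', rfl⟩
  · intro S hS j
    obtain ⟨w, hw, hwe⟩ := hγ' j (hTO j.2)
    have h := himg ξ S hS (Submodule.mem_map_of_mem hw)
    have e : ξ w = -fun s : I => Λ s (b' j) := by
      ext s
      have h1 : w.1 = (0, b' j) := hwe
      simp [ξ, h1]
    rw [e] at h
    have h' := Submodule.neg_mem _ h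
    rw [neg_neg] at h'
    have hfun : (fun t : T => ξ (Γ t)) = fun (t : T) (s : I) => 1 - Λ s (b t) := by
      ext t s
      simp [ξ, Γ, γ, sub_eq_add_neg]
    rwa [hfun] at h'
  · intro S hS j
    obtain ⟨w, hw, hwe⟩ := hγ' j (hTO j.2)
    have h := himg η S hS (Submodule.mem_map_of_mem hw)
    have e : η w = fun s : I => Λ s (b' j) := by
      ext s
      have h1 : w.1 = (0, b' j) := hwe
      simp [η, h1]
    rw [e] at h
    have hfun : (fun t : T => η (Γ t)) = fun (t : T) (s : I) => 1 + Λ s (b t) := by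
      ext t s
      simp [η, Γ, γ]
    rwa [hfun] at h
  · intro S hS j
    have hj : Γ j ∈ Submodule.span ℝ (Γ '' O) := Submodule.subset_span ⟨j, hTO j.2, rfl⟩
    exact himg θ S hS (Submodule.mem_map_of_mem hj)
  · intro j
    ext s
    have := hrel s s.2 j (hOJ (hTO j.2))
    simp only [Pi.mul_apply]
    linear_combination this
  · intro j s h
    have := hlt s s.2 j (hOJ (hTO j.2))
    have h' : Λ s (b j) = 1 := by linear_combination -h
    rw [h'] at this
    norm_num at this
  · intro j s h
    have := hlt s s.2 j (hOJ (hTO j.2))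
    have h' : Λ s (b j) = -1 := by linear_combination h
    rw [h'] at this
    norm_num at this

/-! ### The curvature of a metric `E(s) ds² + 2 F(s,t) ds dt + G(t) dt²` -/

theorem partialD_congr {i : Fin 2} {h h' : ℝ × ℝ → ℝ} {U : Set (ℝ × ℝ)} (hU : IsOpen U)
    (he : ∀ q ∈ U, h q = h' q) {q : ℝ × ℝ} (hq : q ∈ U) : partialD i h q = partialD i h' q := by
  unfold partialD
  rw [Filter.EventuallyEq.fderiv_eq (Filter.eventually_of_mem (hU.mem_nhds hq) he)]

theorem hasDerivAt_partialD_zero {h : ℝ × ℝ → ℝ} {q : ℝ × ℝ} (hh : DifferentiableAt ℝ h q) :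
    HasDerivAt (fun x => h (x, q.2)) (partialD 0 h q) q.1 := by
  have h1 : HasDerivAt (fun x : ℝ => (x, q.2)) ((1 : ℝ), (0 : ℝ)) q.1 :=
    (hasDerivAt_id q.1).prodMk (hasDerivAt_const q.1 q.2)
  exact HasFDerivAt.comp_hasDerivAt (f := fun x : ℝ => (x, q.2)) q.1 hh.hasFDerivAt h1

theorem hasDerivAt_partialD_one {h : ℝ × ℝ → ℝ} {q : ℝ × ℝ} (hh : DifferentiableAt ℝ h q) :
    HasDerivAt (fun y => h (q.1, y)) (partialD 1 h q) q.2 := by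
  have h1 : HasDerivAt (fun y : ℝ => (q.1, y)) ((0 : ℝ), (1 : ℝ)) q.2 :=
    (hasDerivAt_const q.2 q.1).prodMk (hasDerivAt_id q.2)
  exact HasFDerivAt.comp_hasDerivAt (f := fun y : ℝ => (q.1, y)) q.2 hh.hasFDerivAt h1

theorem differentiableAt_partialD {h : ℝ × ℝ → ℝ} {q : ℝ × ℝ} (hh : ContDiffAt ℝ 2 h q)
    (i : Fin 2) : DifferentiableAt ℝ (partialD i h) q := by
  have h1 : ContDiffAt ℝ 1 (fderiv ℝ h) q := hh.fderiv_right (by norm_num)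
  exact (h1.clm_apply contDiffAt_const).differentiableAt (by norm_num)

/-- The Gauss equation for a metric whose diagonal entries depend on one coordinate each. The symbols
`Γᵏ₀₁` vanish, so only `Γᵏ₀₀`, `Γᵏ₁₁` and the `s`-derivatives of the latter enter. -/
theorem coordGaussCurvature_mul_det_sq {γ : ℝ × ℝ → Matrix (Fin 2) (Fin 2) ℝ} {I J : Set ℝ}
    (hI : IsOpen I) (hJ : IsOpen J) {E G : ℝ → ℝ} {F : ℝ × ℝ → ℝ}
    (hγ : ∀ q ∈ I ×ˢ J, γ q = !![E q.1, F q; F q, G q.2])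
    (hE : ∀ s ∈ I, ContDiffAt ℝ 2 E s) (hG : ∀ t ∈ J, ContDiffAt ℝ 2 G t)
    (hF : ∀ q ∈ I ×ˢ J, ContDiffAt ℝ 2 F q)
    (hD : ∀ q ∈ I ×ˢ J, E q.1 * G q.2 - F q ^ 2 ≠ 0) {q : ℝ × ℝ} (hq : q ∈ I ×ˢ J) :
    coordGaussCurvature γ q * (E q.1 * G q.2 - F q ^ 2) ^ 2 =
      partialD 0 (partialD 1 F) q * (E q.1 * G q.2 - F q ^ 2)
      + F q * partialD 0 F q * partialD 1 F q - deriv E q.1 * G q.2 * partialD 1 F q / 2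
      - E q.1 * deriv G q.2 * partialD 0 F q / 2 + deriv E q.1 * deriv G q.2 * F q / 4 := by
  have hU : IsOpen (I ×ˢ J) := hI.prod hJ
  have hF1 : ∀ q ∈ I ×ˢ J, DifferentiableAt ℝ F q := fun q hq =>
    (hF q hq).differentiableAt (by norm_num)
  have hE1 : ∀ s ∈ I, DifferentiableAt ℝ E s := fun s hs =>
    (hE s hs).differentiableAt (by norm_num)
  have hG1 : ∀ t ∈ J, DifferentiableAt ℝ G t := fun t ht =>
    (hG t ht).differentiableAt (by norm_num)
  have hG2 : ∀ t ∈ J, DifferentiableAt ℝ (deriv G) t := fun t ht => by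
    have : ContDiffAt ℝ 1 (deriv G) t := by
      have h := (hG t ht).fderiv_right (m := 1) (by norm_num)
      exact h.clm_apply contDiffAt_const
    exact this.differentiableAt (by norm_num)
  -- first derivatives of the entries of the metric
  have pE : ∀ q ∈ I ×ˢ J, ∀ i, partialD i (fun x => γ x 0 0) q = ![deriv E q.1, 0] i := by
    intro q hq i
    rw [partialD_congr hU (h' := fun x => E x.1) (fun q hq => by simp [hγ q hq]) hq]
    have hd : DifferentiableAt ℝ (fun x : ℝ × ℝ => E x.1) q :=
      (hE1 q.1 hq.1).comp q differentiableAt_fst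
    fin_cases i
    · exact (hasDerivAt_partialD_zero hd).unique (hE1 q.1 hq.1).hasDerivAt
    · exact (hasDerivAt_partialD_one hd).unique (hasDerivAt_const q.2 (E q.1))
  have pG : ∀ q ∈ I ×ˢ J, ∀ i, partialD i (fun x => γ x 1 1) q = ![0, deriv G q.2] i := by
    intro q hq i
    rw [partialD_congr hU (h' := fun x => G x.2) (fun q hq => by simp [hγ q hq]) hq]
    have hd : DifferentiableAt ℝ (fun x : ℝ × ℝ => G x.2) q :=
      (hG1 q.2 hq.2).comp q differentiableAt_snd
    fin_cases i
    · exact (hasDerivAt_partialD_zero hd).unique (hasDerivAt_const q.1 (G q.2))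
    · exact (hasDerivAt_partialD_one hd).unique (hG1 q.2 hq.2).hasDerivAt
  have pF : ∀ q ∈ I ×ˢ J, ∀ i, partialD i (fun x => γ x 0 1) q = partialD i F q := by
    intro q hq i
    exact partialD_congr hU (fun q hq => by simp [hγ q hq]) hq
  have pF' : ∀ q ∈ I ×ˢ J, ∀ i, partialD i (fun x => γ x 1 0) q = partialD i F q := by
    intro q hq i
    exact partialD_congr hU (fun q hq => by simp [hγ q hq]) hq
  have hinv : ∀ q ∈ I ×ˢ J, (γ q)⁻¹ = (E q.1 * G q.2 - F q ^ 2)⁻¹ •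
      !![G q.2, -F q; -F q, E q.1] := by
    intro q hq
    rw [hγ q hq, Matrix.inv_def, Matrix.adjugate_fin_two_of, Matrix.det_fin_two_of,
      Ring.inverse_eq_inv', sq]
  -- Christoffel symbols
  have c01 : ∀ k, ∀ q ∈ I ×ˢ J, christoffel γ k 0 1 q = 0 := by
    intro k q hq
    simp [christoffel, pE q hq, pG q hq, pF q hq, pF' q hq]
  have c00 : ∀ q ∈ I ×ˢ J, christoffel γ 0 0 0 q =
      (deriv E q.1 * G q.2 / 2 - F q * partialD 0 F q) / (E q.1 * G q.2 - F q ^ 2) := by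
    intro q hq
    simp [christoffel, pE q hq, pF q hq, hinv q hq]
    ring
  have c10 : ∀ q ∈ I ×ˢ J, christoffel γ 1 0 0 q =
      (E q.1 * partialD 0 F q - deriv E q.1 * F q / 2) / (E q.1 * G q.2 - F q ^ 2) := by
    intro q hq
    simp [christoffel, pE q hq, pF q hq, hinv q hq]
    ring
  have c011 : ∀ q ∈ I ×ˢ J, christoffel γ 0 1 1 q =
      (G q.2 * partialD 1 F q - F q * deriv G q.2 / 2) / (E q.1 * G q.2 - F q ^ 2) := by
    intro q hq
    simp [christoffel, pG q hq, pF' q hq, hinv q hq]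
    ring
  have c111 : ∀ q ∈ I ×ˢ J, christoffel γ 1 1 1 q =
      (E q.1 * deriv G q.2 / 2 - F q * partialD 1 F q) / (E q.1 * G q.2 - F q ^ 2) := by
    intro q hq
    simp [christoffel, pG q hq, pF' q hq, hinv q hq]
    ring
  -- the derivatives of the Christoffel symbols that enter the curvature
  have dF := hasDerivAt_partialD_zero (hF1 q hq)
  have dFt := hasDerivAt_partialD_zero (differentiableAt_partialD (hF q hq) 1)
  have dE := (hE1 q.1 hq.1).hasDerivAt
  have dD : HasDerivAt (fun x => E x * G q.2 - F (x, q.2) ^ 2)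
      (deriv E q.1 * G q.2 - 2 * F q * partialD 0 F q) q.1 := by
    convert! (dE.mul_const (G q.2)).sub (dF.pow 2) using 1
    norm_num
  have hEd : DifferentiableAt ℝ (fun x : ℝ × ℝ => E x.1) q :=
    (hE1 q.1 hq.1).comp q differentiableAt_fst
  have hGd : DifferentiableAt ℝ (fun x : ℝ × ℝ => G x.2) q :=
    (hG1 q.2 hq.2).comp q differentiableAt_snd
  have hGd' : DifferentiableAt ℝ (fun x : ℝ × ℝ => deriv G x.2) q :=
    (hG2 q.2 hq.2).comp q differentiableAt_snd
  have hFd := hF1 q hq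
  have hFtd := differentiableAt_partialD (hF q hq) 1
  have hDd : DifferentiableAt ℝ (fun x : ℝ × ℝ => E x.1 * G x.2 - F x ^ 2) q :=
    (hEd.mul hGd).sub (hFd.pow 2)
  have d011 : partialD 0 (christoffel γ 0 1 1) q =
      ((G q.2 * partialD 0 (partialD 1 F) q - partialD 0 F q * deriv G q.2 / 2)
        * (E q.1 * G q.2 - F q ^ 2) - (G q.2 * partialD 1 F q - F q * deriv G q.2 / 2)
        * (deriv E q.1 * G q.2 - 2 * F q * partialD 0 F q)) / (E q.1 * G q.2 - F q ^ 2) ^ 2 := by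
    rw [partialD_congr hU c011 hq]
    have hd : DifferentiableAt ℝ (fun q : ℝ × ℝ => (G q.2 * partialD 1 F q
        - F q * deriv G q.2 / 2) / (E q.1 * G q.2 - F q ^ 2)) q := by
      simp only [div_eq_mul_inv _ (E _ * G _ - F _ ^ 2)]
      refine DifferentiableAt.fun_mul ?_ (hDd.fun_inv (hD q hq))
      fun_prop (disch := first | exact hq.1 | exact hq.2)
    exact (hasDerivAt_partialD_zero hd).unique
      (((dFt.const_mul (G q.2)).sub ((dF.mul_const (deriv G q.2)).div_const 2)).div dD (hD q hq))
  have d111 : partialD 0 (christoffel γ 1 1 1) q =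
      ((deriv E q.1 * deriv G q.2 / 2
          - (partialD 0 F q * partialD 1 F q + F q * partialD 0 (partialD 1 F) q))
        * (E q.1 * G q.2 - F q ^ 2) - (E q.1 * deriv G q.2 / 2 - F q * partialD 1 F q)
        * (deriv E q.1 * G q.2 - 2 * F q * partialD 0 F q)) / (E q.1 * G q.2 - F q ^ 2) ^ 2 := by
    rw [partialD_congr hU c111 hq]
    have hd : DifferentiableAt ℝ (fun q : ℝ × ℝ => (E q.1 * deriv G q.2 / 2
        - F q * partialD 1 F q) / (E q.1 * G q.2 - F q ^ 2)) q := by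
      simp only [div_eq_mul_inv _ (E _ * G _ - F _ ^ 2)]
      refine DifferentiableAt.fun_mul ?_ (hDd.fun_inv (hD q hq))
      fun_prop (disch := first | exact hq.1 | exact hq.2)
    exact (hasDerivAt_partialD_zero hd).unique
      ((((dE.mul_const (deriv G q.2)).div_const 2).sub (dF.mul dFt)).div dD (hD q hq))
  have d01 : ∀ k, partialD 1 (christoffel γ k 0 1) q = 0 := by
    intro k
    rw [partialD_congr hU (c01 k) hq]
    simp [partialD]
  have hDq := hD q hq
  have hdet : (γ q).det = E q.1 * G q.2 - F q ^ 2 := by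
    rw [hγ q hq, Matrix.det_fin_two_of, sq]
  have hg0 : γ q 0 0 = E q.1 := by simp [hγ q hq]
  have hg1 : γ q 0 1 = F q := by simp [hγ q hq]
  rw [coordGaussCurvature, hdet]
  simp only [Fin.sum_univ_two, curvatureTensor, d01, c01 _ q hq, d011, d111, hg0, hg1,
    c00 q hq, c10 q hq, c011 q hq, c111 q hq]
  generalize partialD 0 (partialD 1 F) q = Fst
  generalize partialD 0 F q = Fs
  generalize partialD 1 F q = Ft
  field_simp
  ring

/-! ### Constant curvature forces flatness -/

theorem exists_hasDerivAt_primitive {V : Type*} [NormedAddCommGroup V] [NormedSpace ℝ V]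
    [CompleteSpace V] {I : Set ℝ} (hI : IsOpen I) (hIc : I.OrdConnected) {α : ℝ → V}
    (hα : ContinuousOn α I) (s₀ : ℝ) (hs₀ : s₀ ∈ I) :
    ∃ A : ℝ → V, A s₀ = 0 ∧ ∀ s ∈ I, HasDerivAt A (α s) s := by
  refine ⟨fun s => ∫ x in s₀..s, α x, intervalIntegral.integral_same, fun s hs => ?_⟩
  refine intervalIntegral.integral_hasDerivAt_right ?_ ?_ (hα.continuousAt (hI.mem_nhds hs))
  · exact (hα.mono (hIc.uIcc_subset hs₀ hs)).intervalIntegrable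
  · exact hα.stronglyMeasurableAtFilter hI s hs

/-- The case of a metric `ρ² ds² + 2 ρ σ f ds dt + σ² dt²`, where `f(s, t) = B (a s) (b t)`. The
hypothesis `hpde` is its Gauss equation with constant curvature `K`; no norm on the curves `a`, `b`
is involved. -/
theorem curvature_eq_zero_of_normalized {V : Type*} [NormedAddCommGroup V] [NormedSpace ℝ V]
    [FiniteDimensional ℝ V] (B : V →L[ℝ] V →L[ℝ] ℝ) {I J : Set ℝ}
    (hI : IsOpen I) (hIc : I.OrdConnected) (hJ : IsOpen J) (hIne : I.Nonempty) (hJne : J.Nonempty)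
    {ρ σ : ℝ → ℝ} {a b a' b' : ℝ → V} (hρ : ContinuousOn ρ I) (hσ : ContinuousOn σ J)
    (hρ0 : ∀ s ∈ I, 0 < ρ s) (hσ0 : ∀ t ∈ J, 0 < σ t)
    (ha : ∀ s ∈ I, HasDerivAt a (a' s) s) (hb : ∀ t ∈ J, HasDerivAt b (b' t) t)
    (hb' : ContinuousOn b' J)
    (hlt : ∀ s ∈ I, ∀ t ∈ J, B (a s) (b t) ^ 2 < 1) {K : ℝ}
    (hpde : ∀ s ∈ I, ∀ t ∈ J, (1 - B (a s) (b t) ^ 2) * B (a' s) (b' t)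
      + B (a s) (b t) * B (a' s) (b t) * B (a s) (b' t)
        = K * ρ s * σ t * (1 - B (a s) (b t) ^ 2) ^ 2) :
    K = 0 := by
  obtain ⟨s₀, hs₀⟩ := hIne
  have hac : ContinuousOn a I := fun s hs => (ha s hs).continuousAt.continuousWithinAt
  have hbc : ContinuousOn b J := fun t ht => (hb t ht).continuousAt.continuousWithinAt
  obtain ⟨A, hA₀, hA⟩ := exists_hasDerivAt_primitive hI hIc (hρ.smul hac) s₀ hs₀
  -- `g` is the square of the `t`-derivative of the angle between `a s` and `b t`
  let g : ℝ → ℝ → ℝ := fun s t => B (a s) (b' t) ^ 2 / (1 - B (a s) (b t) ^ 2)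
  have hB : ∀ s ∈ I, ∀ w, HasDerivAt (fun x => B (a x) w) (B (a' s) w) s := fun s hs w =>
    (B.flip w).hasFDerivAt.comp_hasDerivAt s (ha s hs)
  have hne : ∀ s ∈ I, ∀ t ∈ J, 1 - B (a s) (b t) ^ 2 ≠ 0 := fun s hs t ht =>
    (sub_pos.mpr (hlt s hs t ht)).ne'
  have hg : ∀ s ∈ I, ∀ t ∈ J,
      HasDerivAt (fun x => g x t) (2 * K * σ t * (ρ s * B (a s) (b' t))) s := by
    intro s hs t ht
    have h1 := ((hB s hs (b' t)).fun_pow 2).fun_div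
      (((hB s hs (b t)).fun_pow 2).const_sub 1) (hne s hs t ht)
    refine h1.congr_deriv ?_
    rw [div_eq_iff (pow_ne_zero 2 (hne s hs t ht))]
    push_cast
    linear_combination 2 * B (a s) (b' t) * hpde s hs t ht
  have hsep : ∀ s ∈ I, ∀ t ∈ J, g s t = g s₀ t + 2 * K * σ t * B (A s) (b' t) := by
    intro s hs t ht
    have hr : ∀ s ∈ I, HasDerivAt (fun x => g s₀ t + 2 * K * σ t * B (A x) (b' t))
        (2 * K * σ t * (ρ s * B (a s) (b' t))) s := by
      intro s hs
      have h1 : HasDerivAt (fun x => B (A x) (b' t)) (B (ρ s • a s) (b' t)) s :=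
        (B.flip (b' t)).hasFDerivAt.comp_hasDerivAt s (hA s hs)
      refine ((h1.const_mul (2 * K * σ t)).const_add (g s₀ t)).congr_deriv ?_
      simp
    exact hI.eqOn_of_deriv_eq hIc.isPreconnected
      (fun s hs => (hg s hs t ht).differentiableAt.differentiableWithinAt)
      (fun s hs => (hr s hs).differentiableAt.differentiableWithinAt)
      (fun s hs => by rw [(hg s hs t ht).deriv, (hr s hs).deriv]) hs₀ (by simp [hA₀]) hs
  let Θ : ℝ → ℝ × V →ₗ[ℝ] ℝ := fun s =>
    LinearMap.coprod LinearMap.id ((2 * K) • (B (A s)).toLinearMap)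
  have hΘ : ∀ s ∈ I, ∀ t ∈ J, Θ s (g s₀ t, σ t • b' t) = g s t := by
    intro s hs t ht
    rw [hsep s hs t ht]
    simp [Θ]
    ring
  have hcb : ∀ s ∈ I, ContinuousOn (fun t => g s t) J := by
    intro s hs
    refine ContinuousOn.div ?_ ?_ (fun t ht => hne s hs t ht)
    · exact ((B (a s)).continuous.comp_continuousOn hb').pow 2
    · exact continuousOn_const.sub (((B (a s)).continuous.comp_continuousOn hbc).pow 2)
  obtain ⟨t, ht, hconst⟩ := exists_constant_slice hIc.isPreconnected hJ hJne
    (fun s => (B (a s)).toLinearMap) b b' hb Θ (fun t => (g s₀ t, σ t • b' t))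
    ((hcb s₀ hs₀).prodMk (hσ.smul hb'))
    (fun t ht => ContinuousOn.congr
      (fun s hs => (hg s hs t ht).continuousAt.continuousWithinAt) (fun s hs => hΘ s hs t ht))
    hlt
    (fun s hs t ht => by
      rw [hΘ s hs t ht]
      exact div_mul_cancel₀ _ (hne s hs t ht))
  by_contra hK
  -- the angle does not depend on `t` to first order at `t`
  have hzero : ∀ s ∈ I, B (a s) (b' t) = 0 := by
    intro s hs
    have h0 : HasDerivAt (fun x => g x t) 0 s := by
      refine (hasDerivAt_const s (g s t)).congr_of_eventuallyEq ?_
      filter_upwards [hI.mem_nhds hs] with x hx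
      rw [← hΘ x hx t ht, ← hΘ s hs t ht]
      exact hconst x hx s hs
    have h1 := (hg s hs t ht).unique h0
    have h2 := hρ0 s hs
    have h3 := hσ0 t ht
    simpa [hK, h2.ne', h3.ne'] using h1
  have hzero' : B (a' s₀) (b' t) = 0 := by
    refine (hB s₀ hs₀ (b' t)).unique ((hasDerivAt_const s₀ (0 : ℝ)).congr_of_eventuallyEq ?_)
    filter_upwards [hI.mem_nhds hs₀] with x hx using hzero x hx
  have h := hpde s₀ hs₀ t ht
  rw [hzero', hzero s₀ hs₀] at h
  have h2 := hρ0 s₀ hs₀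
  have h3 := hσ0 t ht
  have h4 := hne s₀ hs₀ t ht
  simp [hK, h2.ne', h3.ne', h4] at h

/-- A metric `B(α, α) ds² + 2 B(α, β) ds dt + B(β, β) dt²` of constant curvature, with `α` a function
of `s` and `β` a function of `t`, is flat. -/
theorem curvature_eq_zero {V : Type*} [NormedAddCommGroup V] [NormedSpace ℝ V]
    [FiniteDimensional ℝ V] (B : V →L[ℝ] V →L[ℝ] ℝ) {I J : Set ℝ}
    (hI : IsOpen I) (hIc : I.OrdConnected) (hJ : IsOpen J) (hIne : I.Nonempty) (hJne : J.Nonempty)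
    {α β : ℝ → V} (hα : ∀ s ∈ I, ContDiffAt ℝ 2 α s) (hβ : ∀ t ∈ J, ContDiffAt ℝ 2 β t)
    {γ : ℝ × ℝ → Matrix (Fin 2) (Fin 2) ℝ}
    (hγ : ∀ q ∈ I ×ˢ J, γ q = !![B (α q.1) (α q.1), B (α q.1) (β q.2);
      B (α q.1) (β q.2), B (β q.2) (β q.2)])
    (hE : ∀ s ∈ I, 0 < B (α s) (α s)) (hG : ∀ t ∈ J, 0 < B (β t) (β t))
    (hD : ∀ s ∈ I, ∀ t ∈ J, B (α s) (β t) ^ 2 < B (α s) (α s) * B (β t) (β t)) {K : ℝ}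
    (hK : ∀ q ∈ I ×ˢ J, coordGaussCurvature γ q = K) : K = 0 := by
  have hsm : ∀ {α : ℝ → V} {s : ℝ}, ContDiffAt ℝ 2 α s →
      ContDiffAt ℝ 2 (fun s => B (α s) (α s)) s := fun h =>
    (B.contDiff.contDiffAt.comp _ h).clm_apply h
  let ρ : ℝ → ℝ := fun s => √(B (α s) (α s))
  let σ : ℝ → ℝ := fun t => √(B (β t) (β t))
  let a : ℝ → V := fun s => (ρ s)⁻¹ • α s
  let b : ℝ → V := fun t => (σ t)⁻¹ • β t
  have hρ0 : ∀ s ∈ I, 0 < ρ s := fun s hs => Real.sqrt_pos.mpr (hE s hs)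
  have hσ0 : ∀ t ∈ J, 0 < σ t := fun t ht => Real.sqrt_pos.mpr (hG t ht)
  have hρs : ∀ s ∈ I, ContDiffAt ℝ 2 ρ s := fun s hs => (hsm (hα s hs)).sqrt (hE s hs).ne'
  have hσs : ∀ t ∈ J, ContDiffAt ℝ 2 σ t := fun t ht => (hsm (hβ t ht)).sqrt (hG t ht).ne'
  have has : ∀ s ∈ I, ContDiffAt ℝ 2 a s := fun s hs =>
    ((hρs s hs).inv (hρ0 s hs).ne').smul (hα s hs)
  have hbs : ∀ t ∈ J, ContDiffAt ℝ 2 b t := fun t ht =>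
    ((hσs t ht).inv (hσ0 t ht).ne').smul (hβ t ht)
  have hdV : ∀ {f : ℝ → V} {x : ℝ}, ContDiffAt ℝ 2 f x → HasDerivAt f (deriv f x) x := fun h =>
    (h.differentiableAt (by norm_num)).hasDerivAt
  have hd : ∀ {f : ℝ → ℝ} {x : ℝ}, ContDiffAt ℝ 2 f x → HasDerivAt f (deriv f x) x := fun h =>
    (h.differentiableAt (by norm_num)).hasDerivAt
  have hEρ : ∀ s ∈ I, B (α s) (α s) = ρ s ^ 2 := fun s hs => (Real.sq_sqrt (hE s hs).le).symm
  have hGσ : ∀ t ∈ J, B (β t) (β t) = σ t ^ 2 := fun t ht => (Real.sq_sqrt (hG t ht).le).symm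
  -- With `α = ρ a` and `β = σ b` the derivatives of the metric are expressed through `ρ`, `σ` and
  -- the normalized curves `a`, `b`.
  have hF : ∀ q ∈ I ×ˢ J, B (α q.1) (β q.2) = ρ q.1 * σ q.2 * B (a q.1) (b q.2) := by
    intro q hq
    have h1 := (hρ0 q.1 hq.1).ne'
    have h2 := (hσ0 q.2 hq.2).ne'
    simp only [a, b, map_smul, smul_apply, smul_eq_mul]
    field_simp
  have hU : IsOpen (I ×ˢ J) := hI.prod hJ
  have hFs : ∀ q ∈ I ×ˢ J, ContDiffAt ℝ 2 (fun q : ℝ × ℝ => B (α q.1) (β q.2)) q := by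
    intro q hq
    have h1 : ContDiffAt ℝ 2 (fun q : ℝ × ℝ => α q.1) q := (hα q.1 hq.1).comp q contDiffAt_fst
    have h2 : ContDiffAt ℝ 2 (fun q : ℝ × ℝ => β q.2) q := (hβ q.2 hq.2).comp q contDiffAt_snd
    exact (B.contDiff.contDiffAt.comp q h1).clm_apply h2
  have hBa : ∀ s ∈ I, ∀ w, HasDerivAt (fun x => B (a x) w) (B (deriv a s) w) s := fun s hs w =>
    (B.flip w).hasFDerivAt.comp_hasDerivAt s (hdV (has s hs))
  have hBb : ∀ t ∈ J, ∀ v, HasDerivAt (fun x => B v (b x)) (B v (deriv b t)) t := fun t ht v =>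
    (B v).hasFDerivAt.comp_hasDerivAt t (hdV (hbs t ht))
  have hFs' : ∀ q ∈ I ×ˢ J, partialD 0 (fun q : ℝ × ℝ => B (α q.1) (β q.2)) q =
      σ q.2 * (deriv ρ q.1 * B (a q.1) (b q.2) + ρ q.1 * B (deriv a q.1) (b q.2)) := by
    intro q hq
    have h1 := hasDerivAt_partialD_zero ((hFs q hq).differentiableAt (by norm_num))
    have h2 := ((hd (hρs q.1 hq.1)).fun_mul (hBa q.1 hq.1 (b q.2))).const_mul (σ q.2)
    refine (h1.congr_of_eventuallyEq (f₁ := fun x => σ q.2 * (ρ x * B (a x) (b q.2))) ?_).unique h2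
    filter_upwards [hI.mem_nhds hq.1] with x hx
    rw [hF (x, q.2) ⟨hx, hq.2⟩]
    ring
  have hFt' : ∀ q ∈ I ×ˢ J, partialD 1 (fun q : ℝ × ℝ => B (α q.1) (β q.2)) q =
      ρ q.1 * (deriv σ q.2 * B (a q.1) (b q.2) + σ q.2 * B (a q.1) (deriv b q.2)) := by
    intro q hq
    have h1 := hasDerivAt_partialD_one ((hFs q hq).differentiableAt (by norm_num))
    have h2 := ((hd (hσs q.2 hq.2)).fun_mul (hBb q.2 hq.2 (a q.1))).const_mul (ρ q.1)
    refine (h1.congr_of_eventuallyEq (f₁ := fun x => ρ q.1 * (σ x * B (a q.1) (b x))) ?_).unique h2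
    filter_upwards [hJ.mem_nhds hq.2] with x hx
    rw [hF (q.1, x) ⟨hq.1, hx⟩]
    ring
  have hFst' : ∀ q ∈ I ×ˢ J,
      partialD 0 (partialD 1 (fun q : ℝ × ℝ => B (α q.1) (β q.2))) q =
        deriv ρ q.1 * (deriv σ q.2 * B (a q.1) (b q.2) + σ q.2 * B (a q.1) (deriv b q.2))
        + ρ q.1 * (deriv σ q.2 * B (deriv a q.1) (b q.2)
          + σ q.2 * B (deriv a q.1) (deriv b q.2)) := by
    intro q hq
    have h1 := hasDerivAt_partialD_zero (differentiableAt_partialD (hFs q hq) 1)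
    have h2 := (hd (hρs q.1 hq.1)).fun_mul (((hBa q.1 hq.1 (b q.2)).const_mul (deriv σ q.2)).fun_add
      ((hBa q.1 hq.1 (deriv b q.2)).const_mul (σ q.2)))
    refine (h1.congr_of_eventuallyEq (f₁ := fun x => ρ x * (deriv σ q.2 * B (a x) (b q.2)
      + σ q.2 * B (a x) (deriv b q.2))) ?_).unique h2
    filter_upwards [hI.mem_nhds hq.1] with x hx
    rw [hFt' (x, q.2) ⟨hx, hq.2⟩]
  have hE' : ∀ s ∈ I, deriv (fun s => B (α s) (α s)) s = 2 * ρ s * deriv ρ s := by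
    intro s hs
    have h1 : (fun s => B (α s) (α s)) =ᶠ[nhds s] fun s => ρ s ^ 2 := by
      filter_upwards [hI.mem_nhds hs] with x hx using hEρ x hx
    rw [h1.deriv_eq, ((hd (hρs s hs)).fun_pow 2).deriv]
    norm_num
  have hG' : ∀ t ∈ J, deriv (fun t => B (β t) (β t)) t = 2 * σ t * deriv σ t := by
    intro t ht
    have h1 : (fun t => B (β t) (β t)) =ᶠ[nhds t] fun t => σ t ^ 2 := by
      filter_upwards [hJ.mem_nhds ht] with x hx using hGσ x hx
    rw [h1.deriv_eq, ((hd (hσs t ht)).fun_pow 2).deriv]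
    norm_num
  refine curvature_eq_zero_of_normalized B hI hIc hJ hIne hJne (ρ := ρ) (σ := σ) (a := a) (b := b)
    (a' := deriv a) (b' := deriv b)
    (fun s hs => (hρs s hs).continuousAt.continuousWithinAt)
    (fun t ht => (hσs t ht).continuousAt.continuousWithinAt) hρ0 hσ0
    (fun s hs => hdV (has s hs)) (fun t ht => hdV (hbs t ht)) ?_ ?_ ?_
  · intro t ht
    have h := ((hbs t ht).fderiv_right (m := 1) (by norm_num)).clm_apply
      (contDiffAt_const (c := (1 : ℝ)))
    exact h.continuousAt.continuousWithinAt
  · intro s hs t ht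
    have h := hD s hs t ht
    rw [hF (s, t) ⟨hs, ht⟩, hEρ s hs, hGσ t ht, mul_pow, mul_pow] at h
    have h1 := hρ0 s hs
    have h2 := hσ0 t ht
    exact lt_of_mul_lt_mul_left (by simpa using h) (by positivity : 0 ≤ ρ s ^ 2 * σ t ^ 2)
  · intro s hs t ht
    have hq : (s, t) ∈ I ×ˢ J := ⟨hs, ht⟩
    have h := coordGaussCurvature_mul_det_sq hI hJ hγ (fun s hs => hsm (hα s hs))
      (fun t ht => hsm (hβ t ht)) hFs
      (fun q hq => (sub_pos.mpr (hD q.1 hq.1 q.2 hq.2)).ne') hq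
    rw [hK _ hq, hFs' _ hq, hFt' _ hq, hFst' _ hq, hF _ hq] at h
    simp only [hE' s hs, hG' t ht, hEρ s hs, hGσ t ht] at h
    have h1 := (hρ0 s hs).ne'
    have h2 := (hσ0 t ht).ne'
    have h3 : ρ s ^ 3 * σ t ^ 3 ≠ 0 := by positivity
    refine mul_left_cancel₀ h3 ?_
    linear_combination -h

/-! ### Logarithmic derivatives and the first fundamental form of a translation surface -/

section LieGroup

variable {n : ℕ} {G : Type*} [TopologicalSpace G] [ChartedSpace (EuclideanSpace ℝ (Fin n)) G]
  [Group G]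

/-- The left logarithmic derivative `a(s)⁻¹ a'(s)` of a curve in a Lie group. The tangent space at
the identity is identified with the model space through the chart at the identity. -/
def leftLogDeriv (a : ℝ → G) (s : ℝ) : EuclideanSpace ℝ (Fin n) :=
  deriv (fun x => extChartAt (𝓡 n) (1 : G) ((a s)⁻¹ * a x)) s

/-- The right logarithmic derivative `b'(t) b(t)⁻¹` of a curve in a Lie group, in the chart at the
identity. -/
def rightLogDeriv (b : ℝ → G) (t : ℝ) : EuclideanSpace ℝ (Fin n) :=
  deriv (fun y => extChartAt (𝓡 n) (1 : G) (b y * (b t)⁻¹)) t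

theorem contDiffAt_deriv_diag {X : Type*} [NormedAddCommGroup X] [NormedSpace ℝ X]
    {H : ℝ × ℝ → X} {I : Set ℝ} (hI : IsOpen I) (hH : ∀ s ∈ I, ContDiffAt ℝ ∞ H (s, s))
    {s : ℝ} (hs : s ∈ I) : ContDiffAt ℝ 2 (fun s => deriv (fun x => H (s, x)) s) s := by
  have h1 : ContDiffAt ℝ 2 (fun s => fderiv ℝ H (s, s) (0, 1)) s := by
    have h2 : ContDiffAt ℝ 2 (fderiv ℝ H) (s, s) := (hH s hs).fderiv_right (by norm_cast)
    have h3 := ContDiffAt.comp (f := fun s : ℝ => (s, s)) s h2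
      (contDiffAt_id.prodMk contDiffAt_id)
    exact h3.clm_apply contDiffAt_const
  refine h1.congr_of_eventuallyEq ?_
  filter_upwards [hI.mem_nhds hs] with x hx
  have h3 : HasDerivAt (fun y : ℝ => (x, y)) ((0 : ℝ), (1 : ℝ)) x :=
    (hasDerivAt_const x x).prodMk (hasDerivAt_id x)
  exact (HasFDerivAt.comp_hasDerivAt (f := fun y : ℝ => (x, y)) x
    ((hH x hx).differentiableAt (by norm_num)).hasFDerivAt h3).deriv

theorem contDiffAt_extChartAt_one {X : Type*} [NormedAddCommGroup X] [NormedSpace ℝ X]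
    {f : X → G} {p : X} (hf : ContMDiffAt 𝓘(ℝ, X) (𝓡 n) ∞ f p) (h1 : f p = 1) :
    ContDiffAt ℝ ∞ (fun q => extChartAt (𝓡 n) (1 : G) (f q)) p := by
  rw [← contMDiffAt_iff_contDiffAt]
  refine ContMDiffAt.comp p (g := extChartAt (𝓡 n) (1 : G)) ?_ hf
  rw [h1]
  exact contMDiffAt_extChartAt

variable [LieGroup (𝓡 n) ∞ G]

theorem contDiffAt_leftLogDeriv {a : ℝ → G} {I : Set ℝ} (hI : IsOpen I)
    (ha : ContMDiffOn 𝓘(ℝ, ℝ) (𝓡 n) ∞ a I) {s : ℝ} (hs : s ∈ I) :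
    ContDiffAt ℝ 2 (leftLogDeriv (n := n) a) s := by
  refine contDiffAt_deriv_diag (H := fun p => extChartAt (𝓡 n) (1 : G) ((a p.1)⁻¹ * a p.2))
    hI (fun s hs => ?_) hs
  have has := ha.contMDiffAt (hI.mem_nhds hs)
  have h1 : ContMDiffAt 𝓘(ℝ, ℝ × ℝ) (𝓡 n) ∞ (fun p : ℝ × ℝ => a p.1) (s, s) :=
    ContMDiffAt.comp (s, s) (f := Prod.fst) (g := a) has contDiff_fst.contMDiff.contMDiffAt
  have h2 : ContMDiffAt 𝓘(ℝ, ℝ × ℝ) (𝓡 n) ∞ (fun p : ℝ × ℝ => a p.2) (s, s) :=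
    ContMDiffAt.comp (s, s) (f := Prod.snd) (g := a) has contDiff_snd.contMDiff.contMDiffAt
  exact contDiffAt_extChartAt_one (h1.inv.mul h2) (inv_mul_cancel _)

theorem contDiffAt_rightLogDeriv {b : ℝ → G} {J : Set ℝ} (hJ : IsOpen J)
    (hb : ContMDiffOn 𝓘(ℝ, ℝ) (𝓡 n) ∞ b J) {t : ℝ} (ht : t ∈ J) :
    ContDiffAt ℝ 2 (rightLogDeriv (n := n) b) t := by
  refine contDiffAt_deriv_diag (H := fun p => extChartAt (𝓡 n) (1 : G) (b p.2 * (b p.1)⁻¹))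
    hJ (fun t ht => ?_) ht
  have hbt := hb.contMDiffAt (hJ.mem_nhds ht)
  have h1 : ContMDiffAt 𝓘(ℝ, ℝ × ℝ) (𝓡 n) ∞ (fun p : ℝ × ℝ => b p.1) (t, t) :=
    ContMDiffAt.comp (t, t) (f := Prod.fst) (g := b) hbt contDiff_fst.contMDiff.contMDiffAt
  have h2 : ContMDiffAt 𝓘(ℝ, ℝ × ℝ) (𝓡 n) ∞ (fun p : ℝ × ℝ => b p.2) (t, t) :=
    ContMDiffAt.comp (t, t) (f := Prod.snd) (g := b) hbt contDiff_snd.contMDiff.contMDiffAt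
  exact contDiffAt_extChartAt_one (h2.mul h1.inv) (mul_inv_cancel _)

variable (g : Bundle.ContMDiffRiemannianMetric (𝓡 n) ∞ (EuclideanSpace ℝ (Fin n))
  (fun x : G => TangentSpace (𝓡 n) x))

/-- The inner product at the identity, as a bilinear form on the model space. -/
def innerAtOne : EuclideanSpace ℝ (Fin n) →L[ℝ] EuclideanSpace ℝ (Fin n) →L[ℝ] ℝ :=
  g.inner (1 : G)

theorem inner_eq_innerAtOne {y : G} (hy : y = 1) (v w : TangentSpace (𝓡 n) y) :
    g.inner y v w = innerAtOne g (mfderiv (𝓡 n) 𝓘(ℝ, EuclideanSpace ℝ (Fin n))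
      (extChartAt (𝓡 n) (1 : G)) y v) (mfderiv (𝓡 n) 𝓘(ℝ, EuclideanSpace ℝ (Fin n))
      (extChartAt (𝓡 n) (1 : G)) y w) := by
  subst hy
  rw [mfderiv_extChartAt_self]
  rfl

/-- In a bi-invariant metric a map `x` into the group may be translated to the identity before its
first fundamental form is computed. -/
theorem firstFundamentalForm_translate {g : Bundle.ContMDiffRiemannianMetric (𝓡 n) ∞
    (EuclideanSpace ℝ (Fin n)) (fun x : G => TangentSpace (𝓡 n) x)} (hg : IsBiInvariant g)
    {x : ℝ × ℝ → G} {q : ℝ × ℝ}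
    (hx : MDifferentiableAt 𝓘(ℝ, ℝ × ℝ) (𝓡 n) x q) {c d : G} (hcd : c * x q * d = 1)
    (i j : Fin 2) :
    firstFundamentalForm g x q i j =
      innerAtOne g (fderiv ℝ (fun p => extChartAt (𝓡 n) (1 : G) (c * x p * d)) q (coordVec i))
        (fderiv ℝ (fun p => extChartAt (𝓡 n) (1 : G) (c * x p * d)) q (coordVec j)) := by
  have hL : MDifferentiableAt (𝓡 n) (𝓡 n) (fun y : G => c * y) (x q) :=
    (contMDiff_mul_left (I := 𝓡 n) (n := ∞) (a := c)).mdifferentiable (by simp) _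
  have hR : MDifferentiableAt (𝓡 n) (𝓡 n) (fun y : G => y * d) (c * x q) :=
    (contMDiff_mul_right (I := 𝓡 n) (n := ∞) (a := d)).mdifferentiable (by simp) _
  have hψ : MDifferentiableAt (𝓡 n) 𝓘(ℝ, EuclideanSpace ℝ (Fin n)) (extChartAt (𝓡 n) (1 : G))
      (c * x q * d) := by
    rw [hcd]
    exact mdifferentiableAt_extChartAt (mem_chart_source _ _)
  have e : ∀ v : ℝ × ℝ, fderiv ℝ (fun p => extChartAt (𝓡 n) (1 : G) (c * x p * d)) q v =
      mfderiv (𝓡 n) 𝓘(ℝ, EuclideanSpace ℝ (Fin n)) (extChartAt (𝓡 n) (1 : G)) (c * x q * d)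
        (mfderiv (𝓡 n) (𝓡 n) (fun y : G => y * d) (c * x q)
          (mfderiv (𝓡 n) (𝓡 n) (fun y : G => c * y) (x q)
            (mfderiv 𝓘(ℝ, ℝ × ℝ) (𝓡 n) x q v))) := by
    intro v
    have h1 : HasMFDerivAt 𝓘(ℝ, ℝ × ℝ) (𝓡 n) (fun p => c * x p) q _ :=
      HasMFDerivAt.comp q hL.hasMFDerivAt hx.hasMFDerivAt
    have h2 : HasMFDerivAt 𝓘(ℝ, ℝ × ℝ) (𝓡 n) (fun p => c * x p * d) q _ :=
      HasMFDerivAt.comp q (g := fun y : G => y * d) hR.hasMFDerivAt h1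
    have h3 : HasMFDerivAt 𝓘(ℝ, ℝ × ℝ) 𝓘(ℝ, EuclideanSpace ℝ (Fin n))
        (fun p => extChartAt (𝓡 n) (1 : G) (c * x p * d)) q _ :=
      HasMFDerivAt.comp q hψ.hasMFDerivAt h2
    rw [← mfderiv_eq_fderiv, h3.mfderiv]
    rfl
  rw [e, e, ← inner_eq_innerAtOne g hcd, hg.2, hg.1]
  rfl

/-- The metric induced by `(s, t) ↦ a s * b t` is given by the inner products of the logarithmic
derivatives of `a` and `b`. -/
theorem firstFundamentalForm_mul {g : Bundle.ContMDiffRiemannianMetric (𝓡 n) ∞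
    (EuclideanSpace ℝ (Fin n)) (fun x : G => TangentSpace (𝓡 n) x)} (hg : IsBiInvariant g)
    {x : ℝ × ℝ → G} {I J : Set ℝ}
    (hI : IsOpen I) (hJ : IsOpen J) {a b : ℝ → G} (ha : ContMDiffOn 𝓘(ℝ, ℝ) (𝓡 n) ∞ a I)
    (hb : ContMDiffOn 𝓘(ℝ, ℝ) (𝓡 n) ∞ b J) (hx : ∀ s ∈ I, ∀ t ∈ J, x (s, t) = a s * b t)
    {s t : ℝ} (hs : s ∈ I) (ht : t ∈ J) (i j : Fin 2) :
    firstFundamentalForm g x (s, t) i j =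
      innerAtOne g (![leftLogDeriv a s, rightLogDeriv b t] i)
        (![leftLogDeriv a s, rightLogDeriv b t] j) := by
  have has := ha.contMDiffAt (hI.mem_nhds hs)
  have hbt := hb.contMDiffAt (hJ.mem_nhds ht)
  have hev : x =ᶠ[nhds (s, t)] fun p => a p.1 * b p.2 :=
    Filter.eventually_of_mem ((hI.prod hJ).mem_nhds ⟨hs, ht⟩) fun p hp => hx p.1 hp.1 p.2 hp.2
  have h1 : ContMDiffAt 𝓘(ℝ, ℝ × ℝ) (𝓡 n) ∞ (fun p : ℝ × ℝ => a p.1) (s, t) :=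
    ContMDiffAt.comp (s, t) (f := Prod.fst) (g := a) has contDiff_fst.contMDiff.contMDiffAt
  have h2 : ContMDiffAt 𝓘(ℝ, ℝ × ℝ) (𝓡 n) ∞ (fun p : ℝ × ℝ => b p.2) (s, t) :=
    ContMDiffAt.comp (s, t) (f := Prod.snd) (g := b) hbt contDiff_snd.contMDiff.contMDiffAt
  have hxm : ContMDiffAt 𝓘(ℝ, ℝ × ℝ) (𝓡 n) ∞ x (s, t) := (h1.mul h2).congr_of_eventuallyEq hev
  have hcd : (a s)⁻¹ * x (s, t) * (b t)⁻¹ = 1 := by rw [hx s hs t ht]; group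
  let Φ : ℝ × ℝ → EuclideanSpace ℝ (Fin n) :=
    fun p => extChartAt (𝓡 n) (1 : G) ((a s)⁻¹ * x p * (b t)⁻¹)
  have hΦ : DifferentiableAt ℝ Φ (s, t) :=
    (contDiffAt_extChartAt_one ((contMDiffAt_const.mul hxm).mul contMDiffAt_const)
      hcd).differentiableAt (by simp)
  have hΦi : ∀ i, fderiv ℝ Φ (s, t) (coordVec i) = ![leftLogDeriv a s, rightLogDeriv b t] i := by
    intro i
    fin_cases i
    · have h3 : HasDerivAt (fun y : ℝ => (y, t)) ((1 : ℝ), (0 : ℝ)) s :=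
        (hasDerivAt_id s).prodMk (hasDerivAt_const s t)
      have h4 := HasFDerivAt.comp_hasDerivAt (f := fun y : ℝ => (y, t)) s hΦ.hasFDerivAt h3
      refine h4.deriv.symm.trans (Filter.EventuallyEq.deriv_eq ?_)
      filter_upwards [hI.mem_nhds hs] with y hy
      simp [Φ, hx y hy t ht, mul_assoc]
    · have h3 : HasDerivAt (fun y : ℝ => (s, y)) ((0 : ℝ), (1 : ℝ)) t :=
        (hasDerivAt_const t s).prodMk (hasDerivAt_id t)
      have h4 := HasFDerivAt.comp_hasDerivAt (f := fun y : ℝ => (s, y)) t hΦ.hasFDerivAt h3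
      refine h4.deriv.symm.trans (Filter.EventuallyEq.deriv_eq ?_)
      filter_upwards [hJ.mem_nhds ht] with y hy
      simp [Φ, hx s hs y hy]
  rw [firstFundamentalForm_translate hg (hxm.mdifferentiableAt (by simp)) hcd]
  change innerAtOne g (fderiv ℝ Φ (s, t) (coordVec i)) (fderiv ℝ Φ (s, t) (coordVec j)) = _
  rw [hΦi, hΦi]

end LieGroup

section Immersion

variable {n : ℕ} {G : Type*} [TopologicalSpace G] [ChartedSpace (EuclideanSpace ℝ (Fin n)) G]

theorem IsRegularSurface.mfderiv_comp_symm_injective {M : Type*} [TopologicalSpace M]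
    [ChartedSpace (ℝ × ℝ) M] [IsManifold 𝓘(ℝ, ℝ × ℝ) ∞ M] {F : M → G}
    (hF : IsRegularSurface (n := n) F) {φ : OpenPartialHomeomorph M (ℝ × ℝ)}
    (hφ : φ ∈ IsManifold.maximalAtlas 𝓘(ℝ, ℝ × ℝ) ∞ M) {q : ℝ × ℝ} (hq : q ∈ φ.target) :
    Function.Injective (mfderiv 𝓘(ℝ, ℝ × ℝ) (𝓡 n) (F ∘ φ.symm) q) := by
  have hφd : φ.MDifferentiable 𝓘(ℝ, ℝ × ℝ) 𝓘(ℝ, ℝ × ℝ) :=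
    ⟨(contMDiffOn_of_mem_maximalAtlas hφ).mdifferentiableOn (by simp),
      (contMDiffOn_symm_of_mem_maximalAtlas hφ).mdifferentiableOn (by simp)⟩
  rw [mfderiv_comp q (hF.1.mdifferentiable (by simp) _) (hφd.mdifferentiableAt_symm hq)]
  exact (hF.2 _).comp (hφd.symm.mfderiv_injective hq)

variable [IsManifold (𝓡 n) ∞ G]

theorem firstFundamentalForm_pos (g : Bundle.ContMDiffRiemannianMetric (𝓡 n) ∞
    (EuclideanSpace ℝ (Fin n)) (fun x : G => TangentSpace (𝓡 n) x)) {x : ℝ × ℝ → G} {q : ℝ × ℝ}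
    (hx : Function.Injective (mfderiv 𝓘(ℝ, ℝ × ℝ) (𝓡 n) x q)) :
    0 < firstFundamentalForm g x q 0 0 ∧ 0 < firstFundamentalForm g x q 1 1 ∧
      firstFundamentalForm g x q 0 1 ^ 2 <
        firstFundamentalForm g x q 0 0 * firstFundamentalForm g x q 1 1 := by
  -- the form is positive on every nonzero vector `c ∂₀ + d ∂₁`
  have hpos : ∀ c d : ℝ, (c ≠ 0 ∨ d ≠ 0) →
      0 < c ^ 2 * firstFundamentalForm g x q 0 0 + 2 * c * d * firstFundamentalForm g x q 0 1
        + d ^ 2 * firstFundamentalForm g x q 1 1 := by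
    intro c d hcd
    let L : ℝ × ℝ →L[ℝ] TangentSpace (𝓡 n) (x q) := mfderiv 𝓘(ℝ, ℝ × ℝ) (𝓡 n) x q
    have hL : Function.Injective L := hx
    have hne : c • L (coordVec 0) + d • L (coordVec 1) ≠ 0 := by
      rw [← map_smul, ← map_smul, ← map_add]
      intro h
      have h0 := hL (h.trans (map_zero L).symm)
      simp [coordVec] at h0
      tauto
    have h := g.pos (x q) _ hne
    have e : g.inner (x q) (c • L (coordVec 0) + d • L (coordVec 1))
        (c • L (coordVec 0) + d • L (coordVec 1)) =
        c ^ 2 * g.inner (x q) (L (coordVec 0)) (L (coordVec 0))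
        + 2 * c * d * g.inner (x q) (L (coordVec 0)) (L (coordVec 1))
        + d ^ 2 * g.inner (x q) (L (coordVec 1)) (L (coordVec 1)) := by
      have hs := g.symm (x q) (L (coordVec 1)) (L (coordVec 0))
      simp only [map_add, map_smul, add_apply, smul_apply, smul_eq_mul, hs]
      ring
    rw [e] at h
    exact h
  have h0 := hpos 1 0 (Or.inl one_ne_zero)
  have h1 := hpos 0 1 (Or.inr one_ne_zero)
  simp only [one_pow, one_mul, mul_zero, zero_mul, add_zero, zero_add, ne_eq, OfNat.ofNat_ne_zero,
    not_false_eq_true, zero_pow] at h0 h1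
  refine ⟨h0, h1, ?_⟩
  have h2 := hpos (-firstFundamentalForm g x q 0 1) (firstFundamentalForm g x q 0 0)
    (Or.inr h0.ne')
  have h3 : 0 < firstFundamentalForm g x q 0 0 *
      (firstFundamentalForm g x q 0 0 * firstFundamentalForm g x q 1 1
        - firstFundamentalForm g x q 0 1 ^ 2) := by linear_combination h2
  linarith [pos_of_mul_pos_right h3 h0.le]

end Immersion

end TranslationSurface
end

theorem theorem1 {n : ℕ} (hn : 2 ≤ n)
    {G : Type*} [TopologicalSpace G] [ChartedSpace (EuclideanSpace ℝ (Fin n)) G]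
    [Group G] [LieGroup (𝓡 n) ∞ G]
    (g : Bundle.ContMDiffRiemannianMetric (𝓡 n) ∞ (EuclideanSpace ℝ (Fin n))
      (fun x : G => TangentSpace (𝓡 n) x))
    (hg : TranslationSurface.IsBiInvariant g)
    {M : Type*} [TopologicalSpace M] [ChartedSpace (ℝ × ℝ) M]
    [IsManifold 𝓘(ℝ, ℝ × ℝ) ∞ M] [Nonempty M]
    (F : M → G) (hF : TranslationSurface.IsRegularSurface (n := n) F)
    (hT : TranslationSurface.IsTranslationSurface (n := n) F)
    (K : ℝ) (hK : ∀ p : M, TranslationSurface.HasGaussCurvatureAt g F p K) :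
    K = 0 := by
  obtain ⟨p⟩ := ‹Nonempty M›
  obtain ⟨φ, hφ, hp, I, J, a, b, hI, hIc, hJ, hJc, hIJ, ha, hb, hab⟩ := hT p
  have hq : φ p ∈ I ×ˢ J := hIJ ▸ φ.map_source hp
  have hform := fun (q : ℝ × ℝ) (hq : q ∈ I ×ˢ J) =>
    TranslationSurface.firstFundamentalForm_mul hg (x := F ∘ φ.symm) hI hJ ha hb hab hq.1 hq.2
  have hpos := fun (s : ℝ) (hs : s ∈ I) (t : ℝ) (ht : t ∈ J) =>
    TranslationSurface.firstFundamentalForm_pos g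
      (hF.mfderiv_comp_symm_injective hφ (q := (s, t)) (hIJ ▸ ⟨hs, ht⟩))
  refine TranslationSurface.curvature_eq_zero (TranslationSurface.innerAtOne g) hI hIc hJ
    ⟨_, hq.1⟩ ⟨_, hq.2⟩ (α := TranslationSurface.leftLogDeriv a)
    (β := TranslationSurface.rightLogDeriv b)
    (fun s hs => TranslationSurface.contDiffAt_leftLogDeriv hI ha hs)
    (fun t ht => TranslationSurface.contDiffAt_rightLogDeriv hJ hb ht)
    (γ := TranslationSurface.firstFundamentalForm g (F ∘ φ.symm))
    (fun q hq => ?_) (fun s hs => ?_) (fun t ht => ?_) (fun s hs t ht => ?_) (fun q hq => ?_)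
  · ext i j
    rw [hform q hq i j]
    have hsymm : ∀ v w, TranslationSurface.innerAtOne g v w =
      TranslationSurface.innerAtOne g w v := g.symm (1 : G)
    fin_cases i <;> fin_cases j <;> simp [hsymm (TranslationSurface.rightLogDeriv b q.2)]
  · have h := (hpos s hs _ hq.2).1
    rwa [hform (s, (φ p).2) ⟨hs, hq.2⟩] at h
  · have h := (hpos _ hq.1 t ht).2.1
    rwa [hform ((φ p).1, t) ⟨hq.1, ht⟩] at h
  · have h := (hpos s hs t ht).2.2
    simp only [hform (s, t) ⟨hs, ht⟩] at h
    exact h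
  · have hq' : q ∈ φ.target := hIJ ▸ hq
    have h := hK (φ.symm q) φ hφ (φ.map_target hq')
    rwa [φ.right_inv hq'] at h
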